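/- A channel $P$ with finite input alphabet $\mathcal X$ and finite output alphabet $\mathcal Y$ is a family of probability distributions $P_{Y|X}(\cdot\,|\,x)$ on $\mathcal Y$, $x\in\mathcal X$. For a distribution $P_X$ on $\mathcal X$ let $P\circ P_X$ be the resulting output distribution. The KL contraction coefficient of $P$ is $$\eta_{KL}(P)=\sup_{P_X,Q_X}\frac{D(P\circ P_X\,\|\,P\circ Q_X)}{D(P_X\,\|\,Q_X)},$$ the supremum being over the pairs of input distributions with $0<D(P_X\|Q_X)<\infty$. For two channels $P_{Y|X}$ and $Q_{Y'|X}$ with the same input alphabet, $P$ is less noisy than $Q$, written $P\succeq_{\mathrm{l.n.}}Q$, if $I(U:Y)\ge I(U:Y')$ for every joint distribution $P_{UX}$, where $Y$, $Y'$ are the outputs of $P$, $Q$ for the input $X$, so that $U-X-Y$ and $U-X-Y'$ are Markov chains. A channel with input alphabet $\{0,1\}$ and finite output alphabet $\mathcal Y$ is a binary input symmetric output (BISO) channel if there is an involution $y\mapsto -y$ of $\mathcal Y$ with $P_{Y|X}(y|0)=P_{Y|X}(-y|1)$ for all $y$ (for example $\mathcal Y=\{0,\pm1,\dots,\pm l\}$).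 $BSC(p)$, $p\in[0,1]$, denotes the binary symmetric channel, which flips its input bit with probability $p$, and $BEC(\varepsilon)$, $\varepsilon\in[0,1]$, the binary erasure channel, which erases its input bit with probability $\varepsilon$ and otherwise transmits it unchanged. Theorem. Let $F$ be a BISO channel and let $c=\eta_{KL}(F)$. Then there are a binary erasure channel and a binary symmetric channel with KL contraction coefficient $c$, and for every $\varepsilon\in[0,1]$ with $\eta_{KL}(BEC(\varepsilon))=c$ and every $p\in[0,1]$ with $\eta_{KL}(BSC(p))=c$, $$BEC(\varepsilon)\succeq_{\mathrm{l.n.}}F\succeq_{\mathrm{l.n.}}BSC(p).$$ -/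

import Mathlib

open MeasureTheory ProbabilityTheory InformationTheory
open scoped ENNReal

noncomputable section

namespace BISO

/-! Channels are Markov kernels `P : Kernel 𝒳 𝒴`, `P x` being the output law for the input `x`.
The law of the output for a random input with law `μ` is `P ∘ₘ μ`. The binary input alphabet
`{0, 1}` is `Fin 2`. -/

section Information

variable {𝒰 𝒳 𝒴 𝒵 : Type} [MeasurableSpace 𝒰] [MeasurableSpace 𝒳] [MeasurableSpace 𝒴]
  [MeasurableSpace 𝒵]

/-- The mutual information `I(A : B)` of a pair of random variables with joint law `ρ`: the
Kullback-Leibler divergence of the joint law from the product of its marginals. -/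
def mutualInfo (ρ : Measure (𝒰 × 𝒴)) : ℝ≥0∞ :=
  klDiv ρ (ρ.fst.prod ρ.snd)

/-- The joint law of `(U, Y)` when `U - X - Y` is a Markov chain, `(U, X)` has law `ρ` and the
conditional law of `Y` given `X` is the channel `P`. -/
def jointOutput (P : Kernel 𝒳 𝒴) (ρ : Measure (𝒰 × 𝒳)) : Measure (𝒰 × 𝒴) :=
  (Kernel.id ∥ₖ P) ∘ₘ ρ

/-- `P` is less noisy than `Q`: `I(U : Y) ≥ I(U : Y')` for every joint law of `(U, X)` on every
measurable space `𝒰`, where `Y` (resp. `Y'`) is the output of `P` (resp. `Q`) for the input `X`. -/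
def LessNoisy (P : Kernel 𝒳 𝒴) (Q : Kernel 𝒳 𝒵) : Prop :=
  ∀ (𝒰 : Type) [MeasurableSpace 𝒰] (ρ : Measure (𝒰 × 𝒳)) [IsProbabilityMeasure ρ],
    mutualInfo (jointOutput Q ρ) ≤ mutualInfo (jointOutput P ρ)

/-- The KL contraction coefficient: the supremum of `D(P ∘ μ ‖ P ∘ ν) / D(μ ‖ ν)` over all pairs
of input distributions for which this ratio makes sense, `0 < D(μ ‖ ν) < ∞`. -/
def etaKL (P : Kernel 𝒳 𝒴) : ℝ≥0∞ :=
  ⨆ (μ : ProbabilityMeasure 𝒳) (ν : ProbabilityMeasure 𝒳)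
    (_ : klDiv (μ : Measure 𝒳) (ν : Measure 𝒳) ≠ 0)
    (_ : klDiv (μ : Measure 𝒳) (ν : Measure 𝒳) ≠ ∞),
    klDiv (P ∘ₘ (μ : Measure 𝒳)) (P ∘ₘ (ν : Measure 𝒳)) /
      klDiv (μ : Measure 𝒳) (ν : Measure 𝒳)

end Information

/-- A binary input channel with discrete output alphabet is symmetric if some involution `s` of
the output alphabet (`y ↦ -y` when the alphabet is `{0, ±1, …, ±l}`) exchanges the two output
laws: `P(y | 0) = P(s y | 1)`. -/
def IsBISO {𝒴 : Type} [MeasurableSpace 𝒴] (P : Kernel (Fin 2) 𝒴) : Prop :=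
  ∃ s : 𝒴 → 𝒴, Function.Involutive s ∧ ∀ y, P 0 {y} = P 1 {s y}

/-- The binary symmetric channel: the input bit `x` is flipped (to `1 - x`) with probability
`p`. -/
def BSC (p : unitInterval) : Kernel (Fin 2) (Fin 2) :=
  Kernel.ofFunOfCountable fun x =>
    ENNReal.ofReal (1 - (p : ℝ)) • Measure.dirac x + ENNReal.ofReal (p : ℝ) • Measure.dirac (1 - x)

/-- The binary erasure channel: the input bit `x` is received as `Sum.inl x` with probability
`1 - ε`, and replaced by the erasure symbol `Sum.inr ()` with probability `ε`. -/
def BEC (ε : unitInterval) : Kernel (Fin 2) (Fin 2 ⊕ Unit) :=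
  Kernel.ofFunOfCountable fun x =>
    ENNReal.ofReal (1 - (ε : ℝ)) • Measure.dirac (Sum.inl x) +
      ENNReal.ofReal (ε : ℝ) • Measure.dirac (Sum.inr ())

instance : DiscreteMeasurableSpace (Fin 2 ⊕ Unit) :=
  ⟨fun _ => measurableSet_sum_iff.2 ⟨.of_discrete, .of_discrete⟩⟩

instance (p : unitInterval) : IsMarkovKernel (BSC p) := ⟨fun x => ⟨by
  simp [BSC, Kernel.ofFunOfCountable, ← ENNReal.ofReal_add (sub_nonneg.2 p.2.2) p.2.1]⟩⟩

instance (ε : unitInterval) : IsMarkovKernel (BEC ε) := ⟨fun x => ⟨by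
  simp [BEC, Kernel.ofFunOfCountable, ← ENNReal.ofReal_add (sub_nonneg.2 ε.2.2) ε.2.1]⟩⟩

end BISO

end

/-!
Averaging over `U` gives `I(U : Y) = E_U D(P ∘ P_{X|U} ‖ P ∘ P_X)` (`mutualInfo_jointOutput`), so
that `P` is less noisy than `Q` as soon as `D(Q ∘ μ ‖ Q ∘ ν) ≤ D(P ∘ μ ‖ P ∘ ν)` for all pairs of
input laws (`lessNoisy_of_klDiv_le`). It is this stronger domination that holds for the channels of
the theorem.

Encode the law of a bit by its bias, the probability of `0` minus that of `1`, and let `d(x, y)` be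
the divergence of the bits with biases `x` and `y` (`binDiv`). A binary symmetric channel with flip
probability `p` multiplies biases by `1 - 2 p`. A symmetric channel `F` is a mixture of such
channels: if `w y` is the output law for a uniform input and `θ y` the bias of that input
conditioned on the output `y`, then for input biases `a` and `b` the output divergence is
`∑ y, w y * d(a θ y, b θ y)` (`IsBISO.klDiv_comp`).

The key fact is that `t ↦ d(a √t, b √t)` is convex on `[0, 1]` (`binDiv_mul_le_sum`). Indeed the
negative entropy of a bit with bias `x` is a power series in `x ^ 2` with positive coefficients. The
divergence `d` is its Bregman divergence, and each even power is convex, so that `d(a √t, b √t)` is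
a power series in `t` with nonnegative coefficients.

Let `τ = ∑ y, w y * θ y ^ 2` (`biasEnergy`). Convexity between `t = 0` and `t = 1` yields
`d(a θ, b θ) ≤ θ ^ 2 d(a, b)`, hence `D(F ∘ μ ‖ F ∘ ν) ≤ τ D(μ ‖ ν)`. Taking `b = 0` and `a → 0`,
where `d(a, 0)` behaves like `a ^ 2 / 2`, shows that `τ` is optimal, so that the contraction
coefficient of `F` is `τ` (`IsBISO.etaKL_eq`). In particular it is `1 - ε` for the erasure channel
and `(1 - 2 p) ^ 2` for the binary symmetric channel, and both parameters can be chosen to match `τ`.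
The erasure channel scales all divergences by exactly `1 - ε = τ`, so it dominates `F`, and Jensen's
inequality `d(a √τ, b √τ) ≤ ∑ y, w y * d(a θ y, b θ y)` says that `F` dominates the binary symmetric
channel.
-/

namespace BISO

/-! ### Mutual information as an average of divergences -/

theorem compProd_eq_withDensity {𝒰 𝒴 : Type*} [MeasurableSpace 𝒰] [MeasurableSpace 𝒴]
    [MeasurableSpace.CountableOrCountablyGenerated 𝒰 𝒴]
    (m : Measure 𝒰) [IsFiniteMeasure m] (κ η : Kernel 𝒰 𝒴) [IsFiniteKernel κ] [IsFiniteKernel η]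
    (h : ∀ᵐ u ∂m, κ u ≪ η u) :
    m ⊗ₘ κ = (m ⊗ₘ η).withDensity (fun p => Kernel.rnDeriv κ η p.1 p.2) := by
  ext s hs
  rw [withDensity_apply _ hs, Measure.compProd_apply hs,
    ← lintegral_indicator hs, Measure.lintegral_compProd
      ((Kernel.measurable_rnDeriv κ η).indicator hs)]
  refine lintegral_congr_ae ?_
  filter_upwards [h] with u hu
  rw [← Kernel.setLIntegral_rnDeriv hu (hs.preimage measurable_prodMk_left),
    ← lintegral_indicator (hs.preimage measurable_prodMk_left)]
  rfl

theorem klDiv_compProd_eq_lintegral {𝒰 𝒴 : Type*} [MeasurableSpace 𝒰] [MeasurableSpace 𝒴]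
    [MeasurableSpace.CountableOrCountablyGenerated 𝒰 𝒴]
    (m : Measure 𝒰) [IsFiniteMeasure m] (κ η : Kernel 𝒰 𝒴) [IsFiniteKernel κ] [IsFiniteKernel η]
    (h : ∀ᵐ u ∂m, κ u ≪ η u) :
    klDiv (m ⊗ₘ κ) (m ⊗ₘ η) = ∫⁻ u, klDiv (κ u) (η u) ∂m := by
  have hm := Kernel.measurable_rnDeriv κ η
  have hd := compProd_eq_withDensity m κ η h
  have hrn : (m ⊗ₘ κ).rnDeriv (m ⊗ₘ η) =ᵐ[m ⊗ₘ η] fun p => Kernel.rnDeriv κ η p.1 p.2 := by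
    rw [hd]; exact Measure.rnDeriv_withDensity _ hm
  have hac : m ⊗ₘ κ ≪ m ⊗ₘ η := by
    rw [hd]; exact withDensity_absolutelyContinuous _ _
  rw [klDiv_eq_lintegral_klFun_of_ac hac,
    lintegral_congr_ae (hrn.mono fun p hp => by simp only [hp]; rfl),
    Measure.lintegral_compProd (f := fun p : 𝒰 × 𝒴 =>
      ENNReal.ofReal (klFun (Kernel.rnDeriv κ η p.1 p.2).toReal)) (by fun_prop)]
  refine lintegral_congr_ae ?_
  filter_upwards [h] with u hu
  rw [klDiv_eq_lintegral_klFun_of_ac hu]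
  refine lintegral_congr_ae ?_
  filter_upwards [Kernel.rnDeriv_eq_rnDeriv_measure (κ := κ) (η := η) (a := u)] with y hy
  rw [hy]

section Information

variable {𝒰 𝒳 𝒴 𝒵 : Type} [MeasurableSpace 𝒰] [MeasurableSpace 𝒳] [MeasurableSpace 𝒴]
  [MeasurableSpace 𝒵]

/-- On a countable alphabet almost every conditional law is absolutely continuous with respect to
the output law, because a point that is null for a mixture is null for almost every component. -/
theorem ae_absolutelyContinuous_comp [Countable 𝒴] [MeasurableSingletonClass 𝒴]
    (m : Measure 𝒰) [IsFiniteMeasure m] (κ : Kernel 𝒰 𝒴) [IsFiniteKernel κ] :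
    ∀ᵐ u ∂m, κ u ≪ κ ∘ₘ m := by
  have h : ∀ y, (κ ∘ₘ m) {y} = 0 → ∀ᵐ u ∂m, κ u {y} = 0 := fun y hy => by
    rw [Measure.bind_apply (measurableSet_singleton y) κ.aemeasurable,
      lintegral_eq_zero_iff (κ.measurable_coe (measurableSet_singleton y))] at hy
    exact hy
  have h' : ∀ᵐ u ∂m, ∀ y, (κ ∘ₘ m) {y} = 0 → κ u {y} = 0 := by
    rw [ae_all_iff]
    intro y
    by_cases hy : (κ ∘ₘ m) {y} = 0
    · filter_upwards [h y hy] with u hu _ using hu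
    · exact Filter.Eventually.of_forall fun u hu => absurd hu hy
  filter_upwards [h'] with u hu
  intro s hs
  rw [← Set.biUnion_of_singleton s, measure_biUnion_null_iff s.to_countable]
  exact fun y hy => hu y (measure_mono_null (Set.singleton_subset_iff.2 hy) hs)

theorem mutualInfo_compProd [Countable 𝒴] [MeasurableSingletonClass 𝒴]
    (m : Measure 𝒰) [IsProbabilityMeasure m] (κ : Kernel 𝒰 𝒴) [IsMarkovKernel κ] :
    mutualInfo (m ⊗ₘ κ) = ∫⁻ u, klDiv (κ u) (κ ∘ₘ m) ∂m := by
  rw [mutualInfo, Measure.fst_compProd, Measure.snd_compProd, ← Measure.compProd_const,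
    klDiv_compProd_eq_lintegral]
  · rfl
  · exact ae_absolutelyContinuous_comp m κ

/-- `I(U : Y) = E_U D(P ∘ P_{X|U} ‖ P ∘ P_X)`. -/
theorem mutualInfo_jointOutput [StandardBorelSpace 𝒳] [Nonempty 𝒳] [Countable 𝒴]
    [MeasurableSingletonClass 𝒴] (P : Kernel 𝒳 𝒴) [IsMarkovKernel P] (ρ : Measure (𝒰 × 𝒳))
    [IsProbabilityMeasure ρ] :
    mutualInfo (jointOutput P ρ) =
      ∫⁻ u, klDiv (P ∘ₘ ρ.condKernel u) (P ∘ₘ ρ.snd) ∂ρ.fst := by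
  have h : ρ.fst ⊗ₘ ρ.condKernel = ρ := ρ.disintegrate ρ.condKernel
  have h2 : ρ.condKernel ∘ₘ ρ.fst = ρ.snd := by rw [← Measure.snd_compProd, h]
  conv_lhs => rw [jointOutput, ← h, Measure.parallelComp_comp_compProd, mutualInfo_compProd]
  rw [← Measure.comp_assoc, h2]
  simp_rw [Kernel.comp_apply]

/-- Domination of the output divergences for all pairs of input laws implies the less noisy order:
apply it to the input laws `P_{X|U = u}` and `P_X`, and average over `u`. -/
theorem lessNoisy_of_klDiv_le [StandardBorelSpace 𝒳] [Nonempty 𝒳]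
    [Countable 𝒴] [MeasurableSingletonClass 𝒴] [Countable 𝒵] [MeasurableSingletonClass 𝒵]
    (P : Kernel 𝒳 𝒴) (Q : Kernel 𝒳 𝒵) [IsMarkovKernel P] [IsMarkovKernel Q]
    (h : ∀ (μ ν : Measure 𝒳) [IsProbabilityMeasure μ] [IsProbabilityMeasure ν],
      klDiv (Q ∘ₘ μ) (Q ∘ₘ ν) ≤ klDiv (P ∘ₘ μ) (P ∘ₘ ν)) : LessNoisy P Q := by
  intro 𝒰 _ ρ _
  rw [mutualInfo_jointOutput, mutualInfo_jointOutput]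
  exact lintegral_mono fun u => h _ _

end Information

/-! ### The divergence on a finite alphabet -/

/-- The contribution `q * klFun (p / q) = p * log (p / q) + q - p` to the divergence of a letter with
masses `p` and `q`. It is infinite when `p ≠ 0 = q`, which has to be said separately since
`p / 0 = 0`. -/
noncomputable def klTerm (p q : ℝ) : ℝ≥0∞ :=
  if q = 0 then (if p = 0 then 0 else ∞) else ENNReal.ofReal (q * klFun (p / q))

theorem klDiv_eq_sum_klTerm {𝒴 : Type*} [Fintype 𝒴] [MeasurableSpace 𝒴]
    [MeasurableSingletonClass 𝒴] (μ ν : Measure 𝒴) [IsFiniteMeasure μ] [IsFiniteMeasure ν] :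
    klDiv μ ν = ∑ y, klTerm (μ.real {y}) (ν.real {y}) := by
  by_cases h : μ ≪ ν
  · rw [klDiv_eq_lintegral_klFun_of_ac h, lintegral_fintype]
    refine Finset.sum_congr rfl fun y _ => ?_
    have hy : μ.rnDeriv ν y * ν {y} = μ {y} := by
      rw [← Measure.setLIntegral_rnDeriv h {y}, lintegral_singleton]
    by_cases h0 : ν {y} = 0
    · have h1 : μ {y} = 0 := h h0
      simp [klTerm, Measure.real, h0, h1]
    · have h0' : ν.real {y} ≠ 0 := by simp [Measure.real, ENNReal.toReal_eq_zero_iff, h0]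
      have : μ.real {y} / ν.real {y} = (μ.rnDeriv ν y).toReal := by
        rw [div_eq_iff h0', Measure.real, ← hy, ENNReal.toReal_mul, Measure.real]
      rw [klTerm, if_neg h0', this, ENNReal.ofReal_mul measureReal_nonneg, ofReal_measureReal,
        mul_comm]
  · rw [klDiv_of_not_ac h]
    have : ∃ y, ν {y} = 0 ∧ μ {y} ≠ 0 := by
      by_contra! hc
      refine h fun s hs => ?_
      rw [← Set.biUnion_of_singleton s, measure_biUnion_null_iff s.to_countable]
      exact fun y hy => hc y (measure_mono_null (Set.singleton_subset_iff.2 hy) hs)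
    obtain ⟨y, h0, h1⟩ := this
    symm
    rw [ENNReal.sum_eq_top]
    refine ⟨y, Finset.mem_univ _, ?_⟩
    have h1' : μ.real {y} ≠ 0 := by simp [Measure.real, ENNReal.toReal_eq_zero_iff, h1]
    rw [klTerm, if_pos (by simp [Measure.real, h0]), if_neg h1']

theorem klTerm_mul (m p q : ℝ) (hm : 0 ≤ m) :
    klTerm (m * p) (m * q) = ENNReal.ofReal m * klTerm p q := by
  rcases hm.eq_or_lt with rfl | hm
  · simp [klTerm]
  · by_cases hq : q = 0
    · by_cases hp : p = 0 <;> simp [klTerm, hq, hp, hm.ne', hm]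
    · simp only [klTerm, hq, hm.ne', mul_eq_zero, or_self, if_false]
      rw [mul_div_mul_left _ _ hm.ne', mul_assoc, ENNReal.ofReal_mul hm.le]

/-! ### Divergence of two bits -/

section BinaryDivergence

open Real Filter Topology

/-- The divergence of a bit with bias `x` from a bit with bias `y`, where the bias of a bit is the
probability of `0` minus that of `1`. -/
noncomputable def binDiv (x y : ℝ) : ℝ≥0∞ :=
  klTerm ((1 + x) / 2) ((1 + y) / 2) + klTerm ((1 - x) / 2) ((1 - y) / 2)

theorem binDiv_neg (x y : ℝ) : binDiv (-x) (-y) = binDiv x y := by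
  rw [binDiv, binDiv, sub_neg_eq_add, sub_neg_eq_add, ← sub_eq_add_neg, ← sub_eq_add_neg, add_comm]

theorem klTerm_self (p : ℝ) : klTerm p p = 0 := by
  by_cases h : p = 0 <;> simp [klTerm, h, div_self, klFun_one]

theorem binDiv_self (x : ℝ) : binDiv x x = 0 := by simp [binDiv, klTerm_self]

/-- The real number `binDiv x y` for `|x| ≤ 1`, `|y| < 1`, where it is finite. The convention
`0 * log 0 = 0` covers `x = ±1`. -/
noncomputable def binDivReal (x y : ℝ) : ℝ :=
  (1 + x) / 2 * log (1 + x) + (1 - x) / 2 * log (1 - x)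
    - ((1 + x) / 2 * log (1 + y) + (1 - x) / 2 * log (1 - y))

theorem klTerm_half {x y : ℝ} (hx : -1 ≤ x) (hy : -1 < y) :
    klTerm ((1 + x) / 2) ((1 + y) / 2) = ENNReal.ofReal
      ((1 + x) / 2 * log (1 + x) - (1 + x) / 2 * log (1 + y) + (y - x) / 2) := by
  have hy' : 0 < 1 + y := by linarith
  rw [klTerm, if_neg (by positivity), klFun_apply]
  congr 1
  rw [div_div_div_cancel_right₀ two_ne_zero]
  rcases eq_or_lt_of_le hx with rfl | hx
  · norm_num; ring
  · have : 0 < 1 + x := by linarith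
    rw [log_div this.ne' hy'.ne']
    field_simp
    ring

theorem binDiv_eq_ofReal {x y : ℝ} (hx : |x| ≤ 1) (hy : |y| < 1) :
    binDiv x y = ENNReal.ofReal (binDivReal x y) := by
  rw [abs_le] at hx
  rw [abs_lt] at hy
  have key : ∀ x y : ℝ, -1 ≤ x → -1 < y →
      0 ≤ (1 + x) / 2 * log (1 + x) - (1 + x) / 2 * log (1 + y) + (y - x) / 2 := fun x y hx hy => by
    have hy' : 0 < 1 + y := by linarith
    rcases eq_or_lt_of_le hx with rfl | hx
    · norm_num; linarith
    · have hx' : 0 < 1 + x := by linarith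
      have h := Real.log_le_sub_one_of_pos (div_pos hy' hx')
      rw [log_div hy'.ne' hx'.ne', div_sub_one hx'.ne', le_div_iff₀ hx'] at h
      linarith
  have h2 := klTerm_half (x := -x) (y := -y) (by linarith) (by linarith)
  have k1 := key x y hx.1 hy.1
  have k2 := key (-x) (-y) (by linarith) (by linarith)
  rw [binDiv, sub_eq_add_neg 1 x, sub_eq_add_neg 1 y, klTerm_half hx.1 hy.1, h2,
    ← ENNReal.ofReal_add k1 k2]
  congr 1
  rw [binDivReal, sub_eq_add_neg 1 x, sub_eq_add_neg 1 y]
  ring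

theorem binDiv_eq_top {x y : ℝ} (hy : |y| = 1) (h : x ≠ y) : binDiv x y = ∞ := by
  rcases eq_or_eq_neg_of_abs_eq hy with rfl | rfl
  · have : (1 - x) / 2 ≠ 0 := fun h' => h (by linarith)
    simp [binDiv, klTerm, this]
  · have : (1 + x) / 2 ≠ 0 := fun h' => h (by linarith)
    simp [binDiv, klTerm, this]

/-- The Bregman divergence at `(x, y)` of the convex function
`t ↦ t ^ (2 k + 2) / ((2 k + 1) (2 k + 2))`, which is the `k`-th term in the power series of the
negative binary entropy. -/
noncomputable def powGap (k : ℕ) (x y : ℝ) : ℝ :=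
  (x ^ (2 * k + 2) - y ^ (2 * k + 2) - (2 * k + 2) * y ^ (2 * k + 1) * (x - y))
    / ((2 * k + 1) * (2 * k + 2))

/-- Even powers lie above their tangents, by Bernoulli's inequality for `|x| / |y|`. -/
theorem powGap_nonneg (k : ℕ) (x y : ℝ) : 0 ≤ powGap k x y := by
  refine div_nonneg ?_ (by positivity)
  have hx : x ^ (2 * k + 2) = |x| ^ (2 * k + 2) := (Even.pow_abs ⟨k + 1, by ring⟩ x).symm
  have hy : y ^ (2 * k + 2) = |y| ^ (2 * k + 2) := (Even.pow_abs ⟨k + 1, by ring⟩ y).symm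
  have hyx : y ^ (2 * k + 1) * x ≤ |y| ^ (2 * k + 1) * |x| := by
    rw [← abs_pow, ← abs_mul]; exact le_abs_self _
  have main : (2 * k + 2) * (|y| ^ (2 * k + 1) * |x|) ≤
      |x| ^ (2 * k + 2) + (2 * k + 1) * |y| ^ (2 * k + 2) := by
    rcases (abs_nonneg y).eq_or_lt with h0 | h0
    · rw [← h0]; simp
    · have hb := one_add_mul_sub_le_pow (a := |x| / |y|)
        (by have : 0 ≤ |x| / |y| := by positivity
            linarith) (2 * k + 2)
      have := mul_le_mul_of_nonneg_left hb (pow_nonneg h0.le (2 * k + 2))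
      rw [div_pow, mul_div_cancel₀ _ (by positivity)] at this
      have e : |y| ^ (2 * k + 2) * (|x| / |y|) = |y| ^ (2 * k + 1) * |x| := by
        field_simp
        ring
      push_cast at this
      nlinarith [this, e]
  have e : y ^ (2 * k + 2) = y ^ (2 * k + 1) * y := pow_succ _ _
  have hk : (0 : ℝ) ≤ 2 * k + 2 := by positivity
  have := mul_le_mul_of_nonneg_left hyx hk
  rw [← hx, ← hy] at main
  nlinarith

theorem powGap_mul (k : ℕ) (x y s : ℝ) :
    powGap k (x * s) (y * s) = powGap k x y * (s ^ 2) ^ (k + 1) := by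
  rw [powGap, powGap, ← pow_mul]
  ring

theorem powGap_self (k : ℕ) (x : ℝ) : powGap k x x = 0 := by simp [powGap]

/-- The derivative of the negative binary entropy. -/
theorem hasSum_half_log {y : ℝ} (hy : |y| < 1) :
    HasSum (fun k : ℕ => y ^ (2 * k + 1) / (2 * k + 1)) ((log (1 + y) - log (1 - y)) / 2) := by
  convert! (hasSum_log_sub_log_of_abs_lt_one hy).div_const 2 using 2 with k
  ring

/-- The negative entropy of a bit with bias `x`, up to the additive constant `log 2`. -/
theorem hasSum_entropy {x : ℝ} (hx : |x| < 1) :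
    HasSum (fun k : ℕ => x ^ (2 * k + 2) / ((2 * k + 1) * (2 * k + 2)))
      ((1 + x) / 2 * log (1 + x) + (1 - x) / 2 * log (1 - x)) := by
  have hx' := abs_lt.1 hx
  have h1 := (hasSum_half_log hx).mul_left x
  have hsq : |x ^ 2| < 1 := by rw [abs_pow]; exact pow_lt_one₀ (abs_nonneg _) hx two_ne_zero
  have h2 := (hasSum_pow_div_log_of_abs_lt_one hsq).div_const 2
  have hl : log (1 - x ^ 2) = log (1 + x) + log (1 - x) := by
    rw [← log_mul (by linarith) (by linarith)]; congr 1; ring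
  rw [hl] at h2
  convert! h1.sub h2 using 1
  · funext k
    have : (2 * (k : ℝ) + 2) = 2 * (k + 1) := by ring
    rw [this, ← pow_mul]
    field_simp
    ring
  · ring

theorem hasSum_powGap {x y : ℝ} (hx : |x| < 1) (hy : |y| < 1) :
    HasSum (fun k : ℕ => powGap k x y) (binDivReal x y) := by
  convert! ((hasSum_entropy hx).sub (hasSum_entropy hy)).sub
    ((hasSum_half_log hy).mul_right (x - y)) using 1
  · funext k
    rw [powGap]
    field_simp
  · rw [binDivReal]; ring

/-- The partial sums stay below the divergence also at `|x| = 1`, the boundary of the disc of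
convergence. -/
theorem sum_powGap_le_binDivReal {x y : ℝ} (hx : |x| ≤ 1) (hy : |y| < 1) (n : ℕ) :
    ∑ k ∈ Finset.range n, powGap k x y ≤ binDivReal x y := by
  -- Both sides are continuous along `r ↦ (r x, r y)` as `r ↑ 1`, and `|r x| < 1` for `r < 1`.
  have h1 : Tendsto (fun r : ℝ => binDivReal (r * x) (r * y)) (𝓝[<] 1) (𝓝 (binDivReal x y)) := by
    have : ContinuousAt (fun r : ℝ => binDivReal (r * x) (r * y)) 1 := by
      have hy' := abs_lt.1 hy
      have c1 : Continuous fun r : ℝ => (1 + r * x) * log (1 + r * x) :=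
        continuous_mul_log.comp (by fun_prop : Continuous fun r : ℝ => 1 + r * x)
      have c2 : Continuous fun r : ℝ => (1 - r * x) * log (1 - r * x) :=
        continuous_mul_log.comp (by fun_prop : Continuous fun r : ℝ => 1 - r * x)
      have c3 : ContinuousAt (fun r : ℝ => log (1 + r * y)) 1 :=
        ContinuousAt.log (by fun_prop) (by simp; linarith)
      have c4 : ContinuousAt (fun r : ℝ => log (1 - r * y)) 1 :=
        ContinuousAt.log (by fun_prop) (by simp; linarith)
      simp only [binDivReal, div_mul_eq_mul_div]
      fun_prop
    have h := this.tendsto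
    simp only [one_mul] at h
    exact h.mono_left nhdsWithin_le_nhds
  have h2 : Tendsto (fun r : ℝ => ∑ k ∈ Finset.range n, powGap k (r * x) (r * y)) (𝓝[<] 1)
      (𝓝 (∑ k ∈ Finset.range n, powGap k x y)) := by
    have : Continuous fun r : ℝ => ∑ k ∈ Finset.range n, powGap k (r * x) (r * y) := by
      simp only [powGap]; fun_prop
    have h := this.tendsto 1
    simp only [one_mul] at h
    exact h.mono_left nhdsWithin_le_nhds
  refine le_of_tendsto_of_tendsto h2 h1 ?_
  filter_upwards [Ioo_mem_nhdsLT (zero_lt_one (α := ℝ))] with r hr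
  have hr' : ∀ z : ℝ, |z| ≤ 1 → |r * z| < 1 := fun z hz => by
    rw [abs_mul, abs_of_pos hr.1]; nlinarith [hr.1, hr.2, abs_nonneg z]
  exact sum_le_hasSum _ (fun k _ => powGap_nonneg _ _ _) (hasSum_powGap (hr' x hx) (hr' y hy.le))

theorem sum_powGap_le_binDiv {x y : ℝ} (hx : |x| ≤ 1) (hy : |y| ≤ 1) (n : ℕ) :
    ENNReal.ofReal (∑ k ∈ Finset.range n, powGap k x y) ≤ binDiv x y := by
  rcases hy.lt_or_eq with hy | hy
  · rw [binDiv_eq_ofReal hx hy]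
    exact ENNReal.ofReal_le_ofReal (sum_powGap_le_binDivReal hx hy n)
  · by_cases h : x = y
    · subst h; simp [powGap_self]
    · rw [binDiv_eq_top hy h]; exact le_top

/-- The function `t ↦ binDiv (x √t) (y √t)` is convex on `[0, 1]`, because it is a power series in `t`
with nonnegative coefficients `powGap k x y`. Values at `t = 1` may be infinite. -/
theorem binDiv_mul_le_sum {ι : Type*} [Fintype ι] {w θ : ι → ℝ} (hw : ∀ i, 0 ≤ w i)
    (hw1 : ∑ i, w i = 1) (hθ : ∀ i, |θ i| ≤ 1) {x y s : ℝ} (hx : |x| ≤ 1) (hy : |y| ≤ 1)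
    (hs : s ^ 2 = ∑ i, w i * θ i ^ 2) :
    binDiv (x * s) (y * s) ≤ ∑ i, ENNReal.ofReal (w i) * binDiv (x * θ i) (y * θ i) := by
  have hθ2 : ∀ i, θ i ^ 2 ≤ 1 := fun i => (sq_le_one_iff_abs_le_one _).2 (hθ i)
  have hs2 : s ^ 2 ≤ 1 := by
    rw [hs, ← hw1]
    exact Finset.sum_le_sum fun i _ => mul_le_of_le_one_right (hw i) (hθ2 i)
  rcases hs2.lt_or_eq with hs1 | hs1
  · have hs1' : |s| < 1 := (sq_lt_one_iff_abs_lt_one _).1 hs1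
    have hlt : ∀ z : ℝ, |z| ≤ 1 → |z * s| < 1 := fun z hz => by
      rw [abs_mul]; nlinarith [abs_nonneg z, abs_nonneg s]
    have hle : ∀ z : ℝ, |z| ≤ 1 → ∀ i, |z * θ i| ≤ 1 := fun z hz i => by
      rw [abs_mul]; exact mul_le_one₀ hz (abs_nonneg _) (hθ i)
    rw [binDiv_eq_ofReal (hlt x hx).le (hlt y hy)]
    have hlim := ((ENNReal.continuous_ofReal.tendsto _).comp
      (hasSum_powGap (hlt x hx) (hlt y hy)).tendsto_sum_nat)
    refine le_of_tendsto' hlim fun n => ?_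
    simp only [Function.comp]
    calc ENNReal.ofReal (∑ k ∈ Finset.range n, powGap k (x * s) (y * s))
        ≤ ENNReal.ofReal (∑ i, w i * ∑ k ∈ Finset.range n, powGap k (x * θ i) (y * θ i)) := by
          refine ENNReal.ofReal_le_ofReal ?_
          simp_rw [Finset.mul_sum]
          rw [Finset.sum_comm]
          refine Finset.sum_le_sum fun k _ => ?_
          simp_rw [powGap_mul, hs, mul_left_comm (w _)]
          rw [← Finset.mul_sum]
          exact mul_le_mul_of_nonneg_left (pow_arith_mean_le_arith_mean_pow _ _ _
            (fun i _ => hw i) hw1 (fun i _ => sq_nonneg _) _) (powGap_nonneg _ _ _)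
      _ = ∑ i, ENNReal.ofReal (w i) *
            ENNReal.ofReal (∑ k ∈ Finset.range n, powGap k (x * θ i) (y * θ i)) := by
          rw [ENNReal.ofReal_sum_of_nonneg fun i _ => mul_nonneg (hw i)
            (Finset.sum_nonneg fun k _ => powGap_nonneg _ _ _)]
          simp_rw [ENNReal.ofReal_mul (hw _)]
      _ ≤ _ := Finset.sum_le_sum fun i _ => mul_le_mul_right
          (sum_powGap_le_binDiv (hle x hx i) (hle y hy i) n) _
  -- Here all the `θ i` of positive weight are `±1`, so both sides are `binDiv x y`.
  · have habs : ∀ t : ℝ, t ^ 2 = 1 → binDiv (x * t) (y * t) = binDiv x y := fun t ht => by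
      rcases sq_eq_sq_iff_eq_or_eq_neg.1 (ht.trans (one_pow 2).symm) with rfl | rfl
      · simp
      · simp [binDiv_neg]
    rw [habs s hs1]
    have h0 : ∀ i, w i * (1 - θ i ^ 2) = 0 := by
      have : ∑ i, w i * (1 - θ i ^ 2) = 0 := by
        simp_rw [mul_sub, mul_one, Finset.sum_sub_distrib]; linarith
      rw [Finset.sum_eq_zero_iff_of_nonneg fun i _ => mul_nonneg (hw i) (by linarith [hθ2 i])] at this
      exact fun i => this i (Finset.mem_univ i)
    have : ∀ i, ENNReal.ofReal (w i) * binDiv (x * θ i) (y * θ i) =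
        ENNReal.ofReal (w i) * binDiv x y := fun i => by
      rcases mul_eq_zero.1 (h0 i) with h | h
      · simp [h]
      · rw [habs _ (by linarith)]
    simp_rw [this]
    rw [← Finset.sum_mul, ← ENNReal.ofReal_sum_of_nonneg fun i _ => hw i, hw1]
    simp

/-- Strong data processing for the binary symmetric channel: convexity between `0` and `1`. -/
theorem binDiv_mul_le {x y s : ℝ} (hx : |x| ≤ 1) (hy : |y| ≤ 1) (hs : |s| ≤ 1) :
    binDiv (x * s) (y * s) ≤ ENNReal.ofReal (s ^ 2) * binDiv x y := by
  have hs2 : s ^ 2 ≤ 1 := (sq_le_one_iff_abs_le_one _).2 hs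
  have := binDiv_mul_le_sum (ι := Fin 2) (w := ![s ^ 2, 1 - s ^ 2]) (θ := ![1, 0]) (s := s)
    (by intro i; fin_cases i <;> simp [hs2, sq_nonneg]) (by simp)
    (by intro i; fin_cases i <;> simp) hx hy (by simp)
  simpa [binDiv_self] using this

theorem ofReal_sq_le_binDiv {x : ℝ} (hx : |x| ≤ 1) :
    ENNReal.ofReal (x ^ 2 / 2) ≤ binDiv x 0 := by
  simpa [powGap] using sum_powGap_le_binDiv hx (y := 0) (by simp) 1

theorem binDiv_zero_le {x : ℝ} (hx : |x| < 1) :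
    binDiv x 0 ≤ ENNReal.ofReal (x ^ 2 / 2 / (1 - x ^ 2)) := by
  have hx2 : x ^ 2 < 1 := (sq_lt_one_iff_abs_lt_one _).2 hx
  rw [binDiv_eq_ofReal hx.le (by simp)]
  refine ENNReal.ofReal_le_ofReal ?_
  refine hasSum_le (fun k => ?_) (hasSum_powGap hx (by simp))
    ((hasSum_geometric_of_lt_one (sq_nonneg x) hx2).mul_left (x ^ 2 / 2))
  rw [powGap, ← pow_mul]
  have h : (2 : ℝ) ≤ (2 * k + 1) * (2 * k + 2) := by
    have : (0 : ℝ) ≤ k := k.cast_nonneg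
    nlinarith
  have e : x ^ 2 / 2 * x ^ (2 * k) = x ^ (2 * k + 2) / 2 := by ring
  rw [e]
  simp only [ne_eq, Nat.add_eq_zero_iff, OfNat.ofNat_ne_zero, one_ne_zero, and_false,
    not_false_eq_true, zero_pow, mul_zero, sub_zero, zero_mul]
  exact div_le_div_of_nonneg_left (Even.pow_nonneg ⟨k + 1, by ring⟩ _) two_pos h

end BinaryDivergence

/-! ### Symmetric channels as mixtures of binary symmetric channels -/

section Channel

variable {𝒴 : Type} [MeasurableSpace 𝒴]

/-- The bias of the law of a bit: the probability of `0` minus that of `1`. -/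
noncomputable def bias (μ : Measure (Fin 2)) : ℝ := μ.real {0} - μ.real {1}

/-- The mass of `y` under the output law for a uniform input bit. -/
noncomputable def uniformOutput (P : Kernel (Fin 2) 𝒴) (y : 𝒴) : ℝ :=
  ((P 0).real {y} + (P 1).real {y}) / 2

/-- The bias of a uniform input bit conditioned on the output `y`; zero, by `x / 0 = 0`, when `y` is
never received. -/
noncomputable def posteriorBias (P : Kernel (Fin 2) 𝒴) (y : 𝒴) : ℝ :=
  ((P 0).real {y} - (P 1).real {y}) / ((P 0).real {y} + (P 1).real {y})

/-- The mean of the squared posterior bias, that is the `χ²`-information of the channel for a uniform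
input. -/
noncomputable def biasEnergy [Fintype 𝒴] (P : Kernel (Fin 2) 𝒴) : ℝ :=
  ∑ y, uniformOutput P y * posteriorBias P y ^ 2

theorem real_zero_add_real_one (μ : Measure (Fin 2)) [IsProbabilityMeasure μ] :
    μ.real {0} + μ.real {1} = 1 := by
  rw [← Fin.sum_univ_two (fun x => μ.real {x}), sum_measureReal_singleton]
  simp

theorem real_zero_eq (μ : Measure (Fin 2)) [IsProbabilityMeasure μ] :
    μ.real {0} = (1 + bias μ) / 2 := by
  have := real_zero_add_real_one μ
  rw [bias]; linarith

theorem real_one_eq (μ : Measure (Fin 2)) [IsProbabilityMeasure μ] :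
    μ.real {1} = (1 - bias μ) / 2 := by
  have := real_zero_add_real_one μ
  rw [bias]; linarith

theorem abs_bias_le_one (μ : Measure (Fin 2)) [IsProbabilityMeasure μ] : |bias μ| ≤ 1 := by
  have h0 := measureReal_nonneg (μ := μ) (s := {0})
  have h1 := measureReal_nonneg (μ := μ) (s := {1})
  rw [real_zero_eq] at h0
  rw [real_one_eq] at h1
  exact abs_le.2 ⟨by linarith, by linarith⟩

theorem klDiv_eq_binDiv (μ ν : Measure (Fin 2)) [IsProbabilityMeasure μ] [IsProbabilityMeasure ν] :
    klDiv μ ν = binDiv (bias μ) (bias ν) := by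
  rw [klDiv_eq_sum_klTerm, Fin.sum_univ_two, real_zero_eq, real_zero_eq, real_one_eq, real_one_eq,
    binDiv]

theorem uniformOutput_nonneg (P : Kernel (Fin 2) 𝒴) (y : 𝒴) : 0 ≤ uniformOutput P y := by
  have h0 := measureReal_nonneg (μ := P 0) (s := {y})
  have h1 := measureReal_nonneg (μ := P 1) (s := {y})
  rw [uniformOutput]; positivity

theorem abs_posteriorBias_le_one (P : Kernel (Fin 2) 𝒴) (y : 𝒴) : |posteriorBias P y| ≤ 1 := by
  have h0 := measureReal_nonneg (μ := P 0) (s := {y})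
  have h1 := measureReal_nonneg (μ := P 1) (s := {y})
  rw [posteriorBias, abs_div, abs_of_nonneg (add_nonneg h0 h1)]
  exact div_le_one_of_le₀ (abs_le.2 ⟨by linarith, by linarith⟩) (by positivity)

theorem uniformOutput_mul_posteriorBias (P : Kernel (Fin 2) 𝒴) (y : 𝒴) :
    uniformOutput P y * posteriorBias P y = ((P 0).real {y} - (P 1).real {y}) / 2 := by
  have h0 := measureReal_nonneg (μ := P 0) (s := {y})
  have h1 := measureReal_nonneg (μ := P 1) (s := {y})
  rw [uniformOutput, posteriorBias]
  by_cases h : (P 0).real {y} + (P 1).real {y} = 0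
  · have e0 : (P 0).real {y} = 0 := by linarith
    have e1 : (P 1).real {y} = 0 := by linarith
    simp [e0, e1]
  · field_simp

/-- The law of the output for the input bias `b` has mass `m (1 + b θ)` at a letter of uniform output
mass `m` and posterior bias `θ`. -/
theorem comp_real_singleton [MeasurableSingletonClass 𝒴] (P : Kernel (Fin 2) 𝒴)
    [IsMarkovKernel P] (μ : Measure (Fin 2)) [IsProbabilityMeasure μ] (y : 𝒴) :
    (P ∘ₘ μ).real {y} = uniformOutput P y * (1 + bias μ * posteriorBias P y) := by
  have h : (P ∘ₘ μ).real {y} = (P 0).real {y} * μ.real {0} + (P 1).real {y} * μ.real {1} := by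
    simp only [Measure.real]
    rw [Measure.bind_apply (measurableSet_singleton y) P.aemeasurable, lintegral_fintype,
      Fin.sum_univ_two, ENNReal.toReal_add (by finiteness) (by finiteness), ENNReal.toReal_mul,
      ENNReal.toReal_mul]
  have e := uniformOutput_mul_posteriorBias P y
  rw [h, real_zero_eq, real_one_eq, mul_add, mul_left_comm, e, uniformOutput]
  ring

/-- The symmetry of the channel preserves the uniform output law and reverses the posterior bias. -/
theorem IsBISO.exists_symm {P : Kernel (Fin 2) 𝒴} (hP : IsBISO P) :
    ∃ s : 𝒴 → 𝒴, Function.Involutive s ∧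
      ∀ y, uniformOutput P (s y) = uniformOutput P y ∧
        posteriorBias P (s y) = -posteriorBias P y := by
  obtain ⟨s, hs, h⟩ := hP
  have h1 : ∀ y, (P 0).real {y} = (P 1).real {s y} := fun y => by simp [Measure.real, h]
  have h2 : ∀ y, (P 0).real {s y} = (P 1).real {y} := fun y => by rw [h1, hs]
  refine ⟨s, hs, fun y => ⟨?_, ?_⟩⟩
  · rw [uniformOutput, uniformOutput, h2, ← h1, add_comm]
  · rw [posteriorBias, posteriorBias, h2, ← h1, add_comm ((P 1).real {y}), ← neg_div, neg_sub]

variable [Fintype 𝒴]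

theorem biasEnergy_nonneg (P : Kernel (Fin 2) 𝒴) : 0 ≤ biasEnergy P :=
  Finset.sum_nonneg fun y _ => mul_nonneg (uniformOutput_nonneg P y) (sq_nonneg _)

variable [MeasurableSingletonClass 𝒴] (P : Kernel (Fin 2) 𝒴) [IsMarkovKernel P]

theorem sum_uniformOutput : ∑ y, uniformOutput P y = 1 := by
  have h : ∀ x, ∑ y, (P x).real {y} = 1 := fun x => by
    rw [sum_measureReal_singleton]; simp
  simp_rw [uniformOutput]
  rw [← Finset.sum_div, Finset.sum_add_distrib, h, h]
  norm_num

theorem biasEnergy_le_one : biasEnergy P ≤ 1 := by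
  rw [← sum_uniformOutput P]
  exact Finset.sum_le_sum fun y _ => mul_le_of_le_one_right (uniformOutput_nonneg P y)
    ((sq_le_one_iff_abs_le_one _).2 (abs_posteriorBias_le_one P y))

variable {P}

/-- The divergence of two outputs of a symmetric channel, as that of a mixture of binary symmetric
channels with biases `posteriorBias P y` and weights `uniformOutput P y`. -/
theorem IsBISO.klDiv_comp (hP : IsBISO P) (μ ν : Measure (Fin 2)) [IsProbabilityMeasure μ]
    [IsProbabilityMeasure ν] :
    klDiv (P ∘ₘ μ) (P ∘ₘ ν) = ∑ y, ENNReal.ofReal (uniformOutput P y) *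
      binDiv (bias μ * posteriorBias P y) (bias ν * posteriorBias P y) := by
  obtain ⟨s, hs, h⟩ := hP.exists_symm
  have key : ∀ y, klTerm ((P ∘ₘ μ).real {y}) ((P ∘ₘ ν).real {y}) =
      ENNReal.ofReal (uniformOutput P y) * (2 * klTerm ((1 + bias μ * posteriorBias P y) / 2)
        ((1 + bias ν * posteriorBias P y) / 2)) := fun y => by
    have e := klTerm_mul 2 ((1 + bias μ * posteriorBias P y) / 2)
        ((1 + bias ν * posteriorBias P y) / 2) zero_le_two
    rw [ENNReal.ofReal_ofNat, mul_div_cancel₀ _ two_ne_zero, mul_div_cancel₀ _ two_ne_zero] at e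
    rw [comp_real_singleton, comp_real_singleton, klTerm_mul _ _ _ (uniformOutput_nonneg P y), e]
  have key' : ∀ y, klTerm ((P ∘ₘ μ).real {s y}) ((P ∘ₘ ν).real {s y}) =
      ENNReal.ofReal (uniformOutput P y) * (2 * klTerm ((1 - bias μ * posteriorBias P y) / 2)
        ((1 - bias ν * posteriorBias P y) / 2)) := fun y => by
    rw [key, (h y).1, (h y).2, mul_neg, mul_neg, ← sub_eq_add_neg, ← sub_eq_add_neg]
  have hsum := (hs.bijective.sum_comp fun y => klTerm ((P ∘ₘ μ).real {y}) ((P ∘ₘ ν).real {y}))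
  -- Add the sum over the letters to its image under `s`: the terms of `y` and `s y` form a `binDiv`.
  have h2 : 2 * klDiv (P ∘ₘ μ) (P ∘ₘ ν) = 2 * ∑ y, ENNReal.ofReal (uniformOutput P y) *
      binDiv (bias μ * posteriorBias P y) (bias ν * posteriorBias P y) := by
    rw [klDiv_eq_sum_klTerm, two_mul]
    conv_lhs => enter [2]; rw [← hsum]
    rw [← Finset.sum_add_distrib, Finset.mul_sum]
    refine Finset.sum_congr rfl fun y _ => ?_
    rw [key, key', binDiv]
    ring
  exact (ENNReal.mul_right_inj two_ne_zero ENNReal.ofNat_ne_top).1 h2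

theorem IsBISO.klDiv_comp_le (hP : IsBISO P) (μ ν : Measure (Fin 2)) [IsProbabilityMeasure μ]
    [IsProbabilityMeasure ν] :
    klDiv (P ∘ₘ μ) (P ∘ₘ ν) ≤ ENNReal.ofReal (biasEnergy P) * klDiv μ ν := by
  rw [hP.klDiv_comp, klDiv_eq_binDiv, biasEnergy, ENNReal.ofReal_sum_of_nonneg
    fun y _ => mul_nonneg (uniformOutput_nonneg P y) (sq_nonneg _), Finset.sum_mul]
  refine Finset.sum_le_sum fun y _ => ?_
  rw [ENNReal.ofReal_mul (uniformOutput_nonneg P y), mul_assoc]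
  gcongr
  exact binDiv_mul_le (abs_bias_le_one μ) (abs_bias_le_one ν) (abs_posteriorBias_le_one P y)

end Channel

/-! ### Binary symmetric and erasure channels -/

section BinaryChannels

open unitInterval

theorem bias_BSC (p : I) : bias (BSC p 0) = 1 - 2 * p := by
  simp [bias, BSC, Kernel.ofFunOfCountable, Measure.real, ENNReal.toReal_ofReal, p.2.1, p.2.2]
  ring

theorem isBISO_BSC (p : I) : IsBISO (BSC p) := by
  refine ⟨fun y => 1 - y, fun y => by simp, fun y => ?_⟩
  fin_cases y <;> simp [BSC, Kernel.ofFunOfCountable]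

theorem isBISO_BEC (ε : I) : IsBISO (BEC ε) := by
  refine ⟨Sum.map (fun y => 1 - y) id, fun y => by rcases y with y | y <;> simp, fun y => ?_⟩
  rcases y with y | y
  · fin_cases y <;> simp [BEC, Kernel.ofFunOfCountable]
  · simp [BEC, Kernel.ofFunOfCountable]

theorem BSC_real (p : I) (x y : Fin 2) :
    (BSC p x).real {y} = if y = x then 1 - (p : ℝ) else p := by
  fin_cases x <;> fin_cases y <;>
  simp [BSC, Kernel.ofFunOfCountable, Measure.real, ENNReal.toReal_ofReal, p.2.1, p.2.2]

theorem BEC_real_inl (ε : I) (x y : Fin 2) :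
    (BEC ε x).real {Sum.inl y} = if y = x then 1 - (ε : ℝ) else 0 := by
  fin_cases x <;> fin_cases y <;>
  simp [BEC, Kernel.ofFunOfCountable, Measure.real, ENNReal.toReal_ofReal, ε.2.2]

theorem BEC_real_inr (ε : I) (x : Fin 2) (y : Unit) :
    (BEC ε x).real {Sum.inr y} = ε := by
  simp [BEC, Kernel.ofFunOfCountable, Measure.real, ENNReal.toReal_ofReal, ε.2.1]

theorem biasEnergy_BSC (p : I) : biasEnergy (BSC p) = (1 - 2 * p) ^ 2 := by
  simp [biasEnergy, uniformOutput, posteriorBias, BSC_real]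
  ring

theorem biasEnergy_BEC (ε : I) : biasEnergy (BEC ε) = 1 - ε := by
  by_cases h : 1 - (ε : ℝ) = 0
  · simp [biasEnergy, uniformOutput, posteriorBias, BEC_real_inl, BEC_real_inr, h]
  · have e : ((ε : ℝ) - 1) / (1 - ε) = -1 := by rw [← neg_sub, neg_div, div_self h]
    simp [biasEnergy, uniformOutput, posteriorBias, BEC_real_inl, BEC_real_inr, h, e]

theorem klDiv_BSC_comp (p : I) (μ ν : Measure (Fin 2)) [IsProbabilityMeasure μ]
    [IsProbabilityMeasure ν] :
    klDiv (BSC p ∘ₘ μ) (BSC p ∘ₘ ν) =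
      binDiv (bias μ * (1 - 2 * p)) (bias ν * (1 - 2 * p)) := by
  have h0 : posteriorBias (BSC p) 0 = 1 - 2 * p := by simp [posteriorBias, BSC_real]; ring
  have h1 : posteriorBias (BSC p) 1 = -(1 - 2 * p) := by simp [posteriorBias, BSC_real]; ring
  have hu : ∀ y, ENNReal.ofReal (uniformOutput (BSC p) y) = 2⁻¹ := fun y => by
    fin_cases y <;> simp [uniformOutput, BSC_real]
  rw [(isBISO_BSC p).klDiv_comp, Fin.sum_univ_two, hu, hu, h0, h1, mul_neg, mul_neg, binDiv_neg,
    ← add_mul, ENNReal.inv_two_add_inv_two, one_mul]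

theorem klDiv_BEC_comp (ε : I) (μ ν : Measure (Fin 2)) [IsProbabilityMeasure μ]
    [IsProbabilityMeasure ν] :
    klDiv (BEC ε ∘ₘ μ) (BEC ε ∘ₘ ν) = ENNReal.ofReal (1 - ε) * klDiv μ ν := by
  by_cases h : 1 - (ε : ℝ) = 0
  · simp [(isBISO_BEC ε).klDiv_comp, Fintype.sum_sum_type, uniformOutput, posteriorBias,
      BEC_real_inl, BEC_real_inr, h, binDiv_self]
  · have e : ((ε : ℝ) - 1) / (1 - ε) = -1 := by rw [← neg_sub, neg_div, div_self h]
    have h2 : ENNReal.ofReal ((1 - ε) / 2) = ENNReal.ofReal (1 - ε) * 2⁻¹ := by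
      rw [div_eq_mul_inv, ENNReal.ofReal_mul (sub_nonneg.2 ε.2.2)]
      simp
    simp [(isBISO_BEC ε).klDiv_comp, Fintype.sum_sum_type, uniformOutput, posteriorBias,
      BEC_real_inl, BEC_real_inr, h, e, binDiv_self, binDiv_neg, h2, klDiv_eq_binDiv]
    rw [← add_mul, ← mul_add, ENNReal.inv_two_add_inv_two, mul_one]

end BinaryChannels

/-! ### The contraction coefficient -/

section Contraction

open Filter Topology

variable {𝒴 : Type} [MeasurableSpace 𝒴] [Fintype 𝒴] [MeasurableSingletonClass 𝒴]
  {P : Kernel (Fin 2) 𝒴} [IsMarkovKernel P]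

/-- A lower bound on the contraction coefficient, from the input laws with biases `a` and `0`. The
divergence of biases `x` and `0` is `x ^ 2 / 2` to leading order, so the bound is sharp as
`a → 0`. -/
theorem IsBISO.le_etaKL (hP : IsBISO P) {a : ℝ} (ha : a ∈ Set.Ioo (0 : ℝ) 1) :
    ENNReal.ofReal (biasEnergy P * (1 - a ^ 2)) ≤ etaKL P := by
  have ha2 : 0 < 1 - a ^ 2 := by nlinarith [ha.1, ha.2]
  have ha0 : 0 < a ^ 2 / 2 := by have := ha.1; positivity
  have ha1 : |a| < 1 := by rw [abs_of_pos ha.1]; exact ha.2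
  -- The rows `BSC p 0` serve as input laws with prescribed bias.
  let p : unitInterval := ⟨(1 - a) / 2, by linarith [ha.2], by linarith [ha.1]⟩
  let q : unitInterval := ⟨1 / 2, by norm_num, by norm_num⟩
  have hp : bias (BSC p 0) = a := by rw [bias_BSC]; simp only [p]; ring
  have hq : bias (BSC q 0) = 0 := by rw [bias_BSC]; simp only [q]; ring
  have hD : klDiv (BSC p 0) (BSC q 0) = binDiv a 0 := by rw [klDiv_eq_binDiv, hp, hq]
  have hlow := ofReal_sq_le_binDiv ha1.le
  have hup := binDiv_zero_le ha1
  have hne0 : klDiv (BSC p 0) (BSC q 0) ≠ 0 := by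
    rw [hD]
    exact ((ENNReal.ofReal_pos.2 ha0).trans_le hlow).ne'
  have hnetop : klDiv (BSC p 0) (BSC q 0) ≠ ∞ := by
    rw [hD]; exact ne_top_of_le_ne_top ENNReal.ofReal_ne_top hup
  refine le_trans ?_ (le_iSup₂_of_le ⟨BSC p 0, inferInstance⟩ ⟨BSC q 0, inferInstance⟩
    (le_iSup₂_of_le hne0 hnetop le_rfl))
  simp only [ProbabilityMeasure.coe_mk]
  rw [ENNReal.le_div_iff_mul_le (Or.inl hne0) (Or.inl hnetop), hP.klDiv_comp, hD, hp, hq]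
  calc ENNReal.ofReal (biasEnergy P * (1 - a ^ 2)) * binDiv a 0
      ≤ ENNReal.ofReal (biasEnergy P * (1 - a ^ 2)) * ENNReal.ofReal (a ^ 2 / 2 / (1 - a ^ 2)) := by
        gcongr
    _ = ENNReal.ofReal (∑ y, uniformOutput P y * ((a * posteriorBias P y) ^ 2 / 2)) := by
        rw [← ENNReal.ofReal_mul (mul_nonneg (biasEnergy_nonneg P) ha2.le), mul_assoc,
          mul_div_cancel₀ _ ha2.ne', biasEnergy, Finset.sum_mul]
        congr 1
        exact Finset.sum_congr rfl fun y _ => by ring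
    _ = ∑ y, ENNReal.ofReal (uniformOutput P y) *
          ENNReal.ofReal ((a * posteriorBias P y) ^ 2 / 2) := by
        rw [ENNReal.ofReal_sum_of_nonneg fun y _ => mul_nonneg (uniformOutput_nonneg P y)
          (by positivity)]
        exact Finset.sum_congr rfl fun y _ => ENNReal.ofReal_mul (uniformOutput_nonneg P y)
    _ ≤ _ := by
        refine Finset.sum_le_sum fun y _ => ?_
        rw [zero_mul]
        gcongr
        refine ofReal_sq_le_binDiv ?_
        rw [abs_mul]
        exact mul_le_one₀ ha1.le (abs_nonneg _) (abs_posteriorBias_le_one P y)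

/-- The contraction coefficient of a symmetric channel is its `χ²`-information. -/
theorem IsBISO.etaKL_eq (hP : IsBISO P) : etaKL P = ENNReal.ofReal (biasEnergy P) := by
  refine le_antisymm ?_ ?_
  · refine iSup₂_le fun μ ν => iSup₂_le fun h0 h1 => ?_
    exact ENNReal.div_le_of_le_mul (hP.klDiv_comp_le _ _)
  · have hlim : Tendsto (fun a : ℝ => ENNReal.ofReal (biasEnergy P * (1 - a ^ 2))) (𝓝[>] 0)
        (𝓝 (ENNReal.ofReal (biasEnergy P))) := by
      have : Continuous fun a : ℝ => ENNReal.ofReal (biasEnergy P * (1 - a ^ 2)) :=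
        ENNReal.continuous_ofReal.comp (by fun_prop)
      simpa using (this.tendsto 0).mono_left (nhdsWithin_le_nhds (s := Set.Ioi 0))
    refine le_of_tendsto hlim ?_
    filter_upwards [Ioo_mem_nhdsGT (zero_lt_one (α := ℝ))] with a ha using hP.le_etaKL ha

end Contraction

end BISO

theorem theorem1 {𝒴 : Type} [Fintype 𝒴] [MeasurableSpace 𝒴] [MeasurableSingletonClass 𝒴]
    (c : ℝ≥0∞) (F : Kernel (Fin 2) 𝒴) [IsMarkovKernel F]
    (hF : BISO.IsBISO F) (hc : BISO.etaKL F = c) :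
    (∃ ε : unitInterval, BISO.etaKL (BISO.BEC ε) = c) ∧
    (∃ p : unitInterval, BISO.etaKL (BISO.BSC p) = c) ∧
    (∀ ε : unitInterval, BISO.etaKL (BISO.BEC ε) = c → BISO.LessNoisy (BISO.BEC ε) F) ∧
    (∀ p : unitInterval, BISO.etaKL (BISO.BSC p) = c → BISO.LessNoisy F (BISO.BSC p)) := by
  rw [hF.etaKL_eq] at hc
  subst hc
  have hBEC : ∀ ε, BISO.etaKL (BISO.BEC ε) = ENNReal.ofReal (1 - ε) := fun ε => by
    rw [(BISO.isBISO_BEC ε).etaKL_eq, BISO.biasEnergy_BEC]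
  have hBSC : ∀ p, BISO.etaKL (BISO.BSC p) = ENNReal.ofReal ((1 - 2 * p) ^ 2) := fun p => by
    rw [(BISO.isBISO_BSC p).etaKL_eq, BISO.biasEnergy_BSC]
  have h0 := BISO.biasEnergy_nonneg F
  have h1 := BISO.biasEnergy_le_one F
  refine ⟨⟨⟨1 - BISO.biasEnergy F, by linarith, by linarith⟩, ?_⟩,
    ⟨⟨(1 - √(BISO.biasEnergy F)) / 2, ?_, ?_⟩, ?_⟩, fun ε hε => ?_, fun p hp => ?_⟩
  · rw [hBEC, sub_sub_cancel]
  · have := Real.sqrt_le_one.2 h1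
    linarith
  · have := Real.sqrt_nonneg (BISO.biasEnergy F)
    linarith
  · rw [hBSC, mul_div_cancel₀ _ two_ne_zero, sub_sub_cancel, Real.sq_sqrt h0]
  · refine BISO.lessNoisy_of_klDiv_le _ _ fun μ ν _ _ => ?_
    rw [BISO.klDiv_BEC_comp, ← hBEC, hε]
    exact hF.klDiv_comp_le μ ν
  · refine BISO.lessNoisy_of_klDiv_le _ _ fun μ ν _ _ => ?_
    rw [BISO.klDiv_BSC_comp, hF.klDiv_comp]
    -- `(1 - 2 p) ^ 2` is the mean squared posterior bias of `F`, as convexity requires.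
    rw [hBSC, ENNReal.ofReal_eq_ofReal_iff (sq_nonneg _) h0] at hp
    exact BISO.binDiv_mul_le_sum (BISO.uniformOutput_nonneg F) (BISO.sum_uniformOutput F)
      (BISO.abs_posteriorBias_le_one F) (BISO.abs_bias_le_one μ) (BISO.abs_bias_le_one ν) hp
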